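/- **Theorem (logistic regression after random-sign min-wise hashing).** Let $n,L,q\ge 1$ and let $\mathbf X\in[-1,1]^{n\times p}$ have rows $\mathbf x_i$, each with exactly $q$ non-zero entries; put $\mathbf z_i=\{k: X_{ik}\ne 0\}$. Let $\boldsymbol\beta^*\in\mathbb R^p$, $\boldsymbol\gamma\in\mathbb R^n$, and let $Y_1,\dots,Y_n$ be independent with $$Y_i\sim\mathrm{Bernoulli}(p_i),\qquad \log\frac{p_i}{1-p_i}=\mathbf x_i^T\boldsymbol\beta^*+\gamma_i .$$ Let $\pi_1,\dots,\pi_L$ be independent uniformly random permutations of $\{1,\dots,p\}$ and $\boldsymbol\Psi\in\{-1,1\}^{p\times L}$ a matrix of independent uniformly random signs, with $\mathbf Y,\boldsymbol\pi,\boldsymbol\Psi$ independent. Let $\mathbf S\in\mathbb R^{n\times L}$, with rows $\mathbf s_i$, be given by $S_{il}=\Psi_{H_{il}\,l}\,X_{iH_{il}}$, where $H_{il}=\arg\min_{k\in\mathbf z_i}\pi_l(k)$. For $\eta\ge 0$ let $\hat{\mathbf b}^\eta$ be any minimiser of $$\frac1n\sum_{i=1}^n\left[-Y_i\,\mathbf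 s_i^T\mathbf b+\log\{1+\exp(\mathbf s_i^T\mathbf b)\}\right]\quad\text{over } \mathbf b\in\mathbb R^L \text{ with } \|\mathbf b\|_2^2\le(1+\eta)\frac{(2-q/p)\,q\,\|\boldsymbol\beta^*\|_2^2}{L},$$ and let its excess logistic risk be $$\mathcal E(\hat{\mathbf b}^\eta)=\frac1n\sum_{i=1}^n\left[-p_i\,\mathbf s_i^T\hat{\mathbf b}^\eta+\log\{1+\exp(\mathbf s_i^T\hat{\mathbf b}^\eta)\}\right]-\frac1n\sum_{i=1}^n\left[-p_i(\mathbf x_i^T\boldsymbol\beta^*+\gamma_i)+\log\{1+\exp(\mathbf x_i^T\boldsymbol\beta^*+\gamma_i)\}\right].$$ Put $$\tilde p=\frac1n\sum_{i=1}^np_i(1-p_i),\qquad L^*=\sqrt{(2-q/p)\,q\,n}\;\|\boldsymbol\beta^*\|_2,\qquad \rho=\exp\left(-\frac{L\eta^2}{2(2-q/p)(3+2\eta)q}\right).$$ Then $\tilde p\le\frac12$ and $$\mathbb E_{\mathbf Y,\boldsymbol\pi,\boldsymbol\Psi}\{\mathcal E(\hat{\mathbf b}^\eta)\}\le\sqrt{(2-q/p)\,q}\;\|\boldsymbol\beta^*\|_2\left(\frac{\sqrt{(1+\eta)\tilde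 p}+L^*/(4L)}{\sqrt n}\right)+\log(2)\,\rho+\frac{\|\boldsymbol\gamma\|_2^2}{4n}.$$ In particular, for $\boldsymbol\gamma=\mathbf 0$ the last term vanishes. -/

import Mathlib

open scoped BigOperators Matrix

noncomputable section

namespace RandomSignHashing

/-- The set `z_i` of columns in which the `i`-th row of `X` is non-zero. -/
def rowSupport {n p : ℕ} (X : Matrix (Fin n) (Fin p) ℝ) (i : Fin n) : Finset (Fin p) :=
  open Classical in Finset.univ.filter fun k => X i k ≠ 0

/-- The min-wise hash value `M = min_{k ∈ z} σ(k)`. -/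
def minHash {p : ℕ} (z : Finset (Fin p)) (hz : z.Nonempty) (σ : Equiv.Perm (Fin p)) : Fin p :=
  (z.image σ).min' (hz.image σ)

/-- The index `H = argmin_{k ∈ z} σ(k)`, that is, the index in `z` with `σ(H) = M`. -/
def argminHash {p : ℕ} (z : Finset (Fin p)) (hz : z.Nonempty) (σ : Equiv.Perm (Fin p)) : Fin p :=
  σ.symm (minHash z hz σ)

theorem argminHash_mem {p : ℕ} (z : Finset (Fin p)) (hz : z.Nonempty)
    (σ : Equiv.Perm (Fin p)) : argminHash z hz σ ∈ z := by
  obtain ⟨k, hk, hkM⟩ := Finset.mem_image.1 ((z.image σ).min'_mem (hz.image σ))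
  have h : argminHash z hz σ = k := by
    simp only [argminHash, minHash]
    rw [← hkM, Equiv.symm_apply_apply]
  rw [h]
  exact hk

theorem argminHash_le {p : ℕ} (z : Finset (Fin p)) (hz : z.Nonempty)
    (σ : Equiv.Perm (Fin p)) (k : Fin p) (hk : k ∈ z) : σ (argminHash z hz σ) ≤ σ k := by
  simp only [argminHash, minHash, Equiv.apply_symm_apply]
  exact Finset.min'_le _ _ (Finset.mem_image_of_mem σ hk)

/-- The random-sign min-wise hashing matrix `S`, with `S_{il} = Ψ_{H_{il} l} X_{i H_{il}}` and
`H_{il} = argmin_{k ∈ z_i} π_l(k)`. Signs are elements of `ℤˣ = {1, -1}`. (A row of `X` without a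
non-zero entry has no `H_{il}`; it is sent to the zero row.) -/
def hashedMatrix {n p L : ℕ} (X : Matrix (Fin n) (Fin p) ℝ) (π : Fin L → Equiv.Perm (Fin p))
    (Ψ : Matrix (Fin p) (Fin L) ℤˣ) : Matrix (Fin n) (Fin L) ℝ :=
  Matrix.of fun i l =>
    open Classical in
    if hz : (rowSupport X i).Nonempty then
      ((Ψ (argminHash (rowSupport X i) hz (π l)) l : ℤ) : ℝ) *
        X i (argminHash (rowSupport X i) hz (π l))
    else 0

/-- The numerical class label, `0` or `1`. -/
def labelValue (y : Bool) : ℝ := if y then 1 else 0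

/-- The probability of the label vector `y` when the labels are independent and the `i`-th is
Bernoulli with success probability `P i`. -/
def labelProb {n : ℕ} (P : Fin n → ℝ) (y : Fin n → Bool) : ℝ :=
  ∏ i, if y i then P i else 1 - P i

/-- The expectation over independent Bernoulli labels `Y` with success probabilities `P`,
independent uniformly random permutations `π_1, …, π_L` and independent uniformly random signs
`Ψ_{kl}`, all three families being independent of each other. (`𝔼` is the uniform average over a
finite type.) -/
def expectation {n p L : ℕ} (P : Fin n → ℝ)
    (F : (Fin n → Bool) → (Fin L → Equiv.Perm (Fin p)) → Matrix (Fin p) (Fin L) ℤˣ → ℝ) : ℝ :=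
  ∑ y : Fin n → Bool, labelProb P y *
    Finset.expect Finset.univ fun π : Fin L → Equiv.Perm (Fin p) =>
      Finset.expect Finset.univ fun Ψ : Fin p → Fin L → ℤˣ => F y π (Matrix.of Ψ)

/-- The average logistic loss `(1/n) ∑ᵢ [-tᵢ uᵢ + log(1 + exp uᵢ)]` of the linear predictor `u`
against the targets `t`: the empirical risk for `t = Y`, the risk for `t` the vector of success
probabilities. -/
def logisticRisk {n : ℕ} (t u : Fin n → ℝ) : ℝ :=
  (1 / (n : ℝ)) * ∑ i, (-(t i * u i) + Real.log (1 + Real.exp (u i)))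

/-- `b` is a solution of `ℓ₂`-constrained logistic regression of the labels `y` on the design
matrix `S`, under the constraint `‖b‖₂² ≤ B`. -/
def IsConstrainedLogisticFit {n L : ℕ} (S : Matrix (Fin n) (Fin L) ℝ) (y : Fin n → Bool)
    (B : ℝ) (b : EuclideanSpace ℝ (Fin L)) : Prop :=
  ‖b‖ ^ 2 ≤ B ∧
    ∀ b' : EuclideanSpace ℝ (Fin L), ‖b'‖ ^ 2 ≤ B →
      logisticRisk (fun i => labelValue (y i)) (S *ᵥ b.ofLp) ≤
        logisticRisk (fun i => labelValue (y i)) (S *ᵥ b'.ofLp)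

/-- The excess logistic risk of the coefficient vector `b` on `S`, relative to the true log-odds
`X β + γ`, when the success probabilities are `P`. -/
def excessRisk {n p L : ℕ} (X : Matrix (Fin n) (Fin p) ℝ) (β : EuclideanSpace ℝ (Fin p))
    (γ : EuclideanSpace ℝ (Fin n)) (P : Fin n → ℝ) (S : Matrix (Fin n) (Fin L) ℝ)
    (b : EuclideanSpace ℝ (Fin L)) : ℝ :=
  logisticRisk P (S *ᵥ b.ofLp) - logisticRisk P (X *ᵥ β.ofLp + γ.ofLp)

/-- `p̃ = (1/n) ∑ᵢ pᵢ (1 - pᵢ)`. -/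
def pTilde {n : ℕ} (P : Fin n → ℝ) : ℝ := (1 / (n : ℝ)) * ∑ i, P i * (1 - P i)

/-- `L* = √((2 - q/p) q n) ‖β‖₂`. -/
def Lstar (n p q : ℕ) (β : EuclideanSpace ℝ (Fin p)) : ℝ :=
  Real.sqrt ((2 - (q : ℝ) / p) * q * n) * ‖β‖

/-- `ρ = exp(-L η² / (2 (2 - q/p) (3 + 2η) q))`. -/
def rho (p q L : ℕ) (η : ℝ) : ℝ :=
  Real.exp (-((L : ℝ) * η ^ 2 / (2 * (2 - (q : ℝ) / p) * (3 + 2 * η) * q)))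

end RandomSignHashing

end

/-!
Write `V = (2 - q / p) q` and let `f = X β + γ` be the true log-odds, so that the success
probabilities are `σ (f i)` for the logistic function `σ`.

The hashed design `S` can reproduce `X β` on average. For weights `w` on the hash values put
`b*_l = (1 / L) ∑ₖ Ψₖₗ βₖ w (π_l k)`. Averaging over the signs leaves in `(S b*)ᵢ` only the term of
the hashed index, so `S b*` is unbiased as soon as `w (σ k)`, restricted to the permutations `σ` for
which `k` is the hashed index of a `q`-set, has mean one. The weights proportional to the
probability that the minimum of a `q`-set sits at a given element with a given value achieve this
with `w ≤ V` and `E w² ≤ V` (`exists_hash_weights`); that probability is a ratio of falling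
factorials (`card_permsAbove_mul`), and the bound on `E w²` is an induction on `p`
(`sq_mul_descFactorial_sq_le`). Three facts about `b*` follow.

* `E ‖b*‖² ≤ V ‖β‖² / L`, and `‖b*‖²` exceeds `(1 + η)` times this bound with probability at most
  `ρ` (`expect_norm_gt_le`): the coordinates are independent Rademacher sums given the permutations,
  so their squares have the moment generating function of scaled `χ²` variables, and Bernstein's
  inequality applies.
* `(S b*)ᵢ` has mean `(X β)ᵢ` (`expect_hashedEntry_mul_weightedSignSum`).
* Its variance is at most `V ‖β‖² / L`, since it averages `L` independent copies
  (`expect_comparator_sub_sq_le`).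

For a fixed design, compare the fit with a feasible vector `b`: with `b*` when it satisfies the norm
constraint, and with `0`, of risk `log 2`, otherwise. The empirical and the true risk differ by a
linear form in the noise `Y - P`, which has mean zero at `b` and is controlled at the fit by
Cauchy–Schwarz and the variances `pᵢ (1 - pᵢ)` (`sum_labelProb_mul_risk_fit_le`). The excess risk of
`b*` is at most `(1 / 8 n) ‖S b* - f‖²`, because the second derivative of `log (1 + exp u)` is at
most `1 / 4` (`log_one_add_exp_le_tangent_add_sq`), and `‖S b* - f‖²` is split into
`2 ‖S b* - X β‖² + 2 ‖γ‖²`. Averaging over the designs gives the bound.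
-/

namespace RandomSignHashing

/-! ### Weighted sums over finite product spaces -/

section ProductSpace

variable {ι Ω : Type*} [Fintype ι] [DecidableEq ι] [Fintype Ω]

theorem sum_prod_mul_prod (μ f : ι → Ω → ℝ) :
    ∑ ω : ι → Ω, (∏ i, μ i (ω i)) * ∏ i, f i (ω i) = ∏ i, ∑ x, μ i x * f i x := by
  rw [Fintype.prod_sum]
  exact Finset.sum_congr rfl fun ω _ => (Finset.prod_mul_distrib).symm

theorem sum_prod_eq_one (μ : ι → Ω → ℝ) (hμ : ∀ i, ∑ x, μ i x = 1) :
    ∑ ω : ι → Ω, ∏ i, μ i (ω i) = 1 := by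
  have h := sum_prod_mul_prod μ fun _ _ => 1
  simpa [hμ] using h

theorem sum_prod_mul_apply (μ : ι → Ω → ℝ) (hμ : ∀ i, ∑ x, μ i x = 1) (i : ι) (g : Ω → ℝ) :
    ∑ ω : ι → Ω, (∏ j, μ j (ω j)) * g (ω i) = ∑ x, μ i x * g x := by
  have h := sum_prod_mul_prod μ fun j x => if j = i then g x else 1
  rw [Finset.prod_eq_single i (fun j _ hj => by simp [hj, hμ]) (by simp)] at h
  simpa [Finset.prod_ite_eq'] using h

theorem sum_prod_mul_apply_mul_apply (μ : ι → Ω → ℝ) {i j : ι} (hij : i ≠ j) (f g : Ω → ℝ)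
    (hμ : ∀ i, ∑ x, μ i x = 1) :
    ∑ ω : ι → Ω, (∏ k, μ k (ω k)) * (f (ω i) * g (ω j)) =
      (∑ x, μ i x * f x) * ∑ x, μ j x * g x := by
  have h := sum_prod_mul_prod μ fun k x => if k = i then f x else if k = j then g x else 1
  have key : ∀ F : ι → ℝ, (∀ k, k ≠ i → k ≠ j → F k = 1) → ∏ k, F k = F i * F j := fun F hF =>
    Finset.prod_eq_mul i j hij (fun k _ hk => hF k hk.1 hk.2) (by simp) (by simp)
  rw [key _ fun k hi hj => by simp [hi, hj, hμ]] at h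
  simp only [if_true, hij.symm, if_false] at h
  rw [← h]
  refine Finset.sum_congr rfl fun ω _ => ?_
  rw [key (fun k => if k = i then f (ω k) else if k = j then g (ω k) else 1)
    fun k hi hj => by simp [hi, hj]]
  simp [hij.symm]

/-- Bienaymé's identity: the second moment of a sum of independent centred variables. -/
theorem sum_prod_mul_sum_sq (μ g : ι → Ω → ℝ) (hμ : ∀ i, ∑ x, μ i x = 1)
    (hg : ∀ i, ∑ x, μ i x * g i x = 0) :
    ∑ ω : ι → Ω, (∏ i, μ i (ω i)) * (∑ i, g i (ω i)) ^ 2 = ∑ i, ∑ x, μ i x * g i x ^ 2 := by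
  have expand : ∀ ω : ι → Ω, (∏ i, μ i (ω i)) * (∑ i, g i (ω i)) ^ 2 =
      ∑ i, ∑ j, (∏ k, μ k (ω k)) * (g i (ω i) * g j (ω j)) := fun ω => by
    rw [sq, Finset.sum_mul_sum, Finset.mul_sum]
    exact Finset.sum_congr rfl fun i _ => Finset.mul_sum _ _ _
  simp_rw [expand]
  rw [Finset.sum_comm]
  refine Finset.sum_congr rfl fun i _ => ?_
  rw [Finset.sum_comm, Finset.sum_eq_single i]
  · rw [← sum_prod_mul_apply μ hμ i fun x => g i x ^ 2]
    exact Finset.sum_congr rfl fun ω _ => by ring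
  · intro j _ hj
    rw [sum_prod_mul_apply_mul_apply μ hj.symm (g i) (g j) hμ, hg, zero_mul]
  · simp

theorem expect_eq_sum_inv_card_mul {α : Type*} [Fintype α] (f : α → ℝ) :
    Finset.expect Finset.univ f = ∑ x, (Fintype.card α : ℝ)⁻¹ * f x := by
  rw [Fintype.expect_eq_sum_div_card, div_eq_inv_mul, Finset.mul_sum]

theorem expect_pi_eq_sum (F : (ι → Ω) → ℝ) :
    Finset.expect Finset.univ F = ∑ ω, (∏ _i : ι, (Fintype.card Ω : ℝ)⁻¹) * F ω := by
  rw [expect_eq_sum_inv_card_mul]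
  simp

theorem sum_inv_card [Nonempty Ω] : ∑ _x : Ω, (Fintype.card Ω : ℝ)⁻¹ = 1 := by
  simp

theorem expect_pi_prod (f : ι → Ω → ℝ) :
    (Finset.expect Finset.univ fun ω : ι → Ω => ∏ i, f i (ω i)) =
      ∏ i, Finset.expect Finset.univ (f i) := by
  rw [expect_pi_eq_sum, sum_prod_mul_prod (fun _ _ => (Fintype.card Ω : ℝ)⁻¹) f]
  simp_rw [expect_eq_sum_inv_card_mul]

theorem expect_pi_sum_sq [Nonempty Ω] (g : ι → Ω → ℝ)
    (hg : ∀ i, Finset.expect Finset.univ (g i) = 0) :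
    (Finset.expect Finset.univ fun ω : ι → Ω => (∑ i, g i (ω i)) ^ 2) =
      ∑ i, Finset.expect Finset.univ fun x => g i x ^ 2 := by
  rw [expect_pi_eq_sum, sum_prod_mul_sum_sq (fun _ _ => (Fintype.card Ω : ℝ)⁻¹) g
    (fun _ => sum_inv_card) fun i => by rw [← expect_eq_sum_inv_card_mul]; exact hg i]
  simp_rw [expect_eq_sum_inv_card_mul]

theorem expect_pi_apply_mul_apply [Nonempty Ω] {i j : ι} (hij : i ≠ j) (f g : Ω → ℝ) :
    (Finset.expect Finset.univ fun ω : ι → Ω => f (ω i) * g (ω j)) =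
      Finset.expect Finset.univ f * Finset.expect Finset.univ g := by
  rw [expect_pi_eq_sum, sum_prod_mul_apply_mul_apply (fun _ _ => (Fintype.card Ω : ℝ)⁻¹) hij f g
    fun _ => sum_inv_card]
  simp_rw [expect_eq_sum_inv_card_mul]

end ProductSpace

/-! ### Rademacher sums -/

theorem expect_sign (f : ℤˣ → ℝ) : Finset.expect Finset.univ f = (f 1 + f (-1)) / 2 := by
  rw [Fintype.expect_eq_sum_div_card]
  simp [Fintype.card_units_int, show (Finset.univ : Finset ℤˣ) = {1, -1} from rfl]

theorem sign_mul_self (u : ℤˣ) : ((u : ℤ) : ℝ) * ((u : ℤ) : ℝ) = 1 := by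
  rcases Int.units_eq_one_or u with rfl | rfl <;> simp

theorem expect_sign_mul_sign {κ : Type*} [Fintype κ] [DecidableEq κ] (j k : κ) :
    (Finset.expect Finset.univ fun ψ : κ → ℤˣ => ((ψ j : ℤ) : ℝ) * ((ψ k : ℤ) : ℝ)) =
      if j = k then 1 else 0 := by
  split_ifs with h
  · subst h
    simp_rw [sign_mul_self]
    exact Fintype.expect_const 1
  · rw [expect_pi_apply_mul_apply h (fun u : ℤˣ => ((u : ℤ) : ℝ)) (fun u : ℤˣ => ((u : ℤ) : ℝ)),
      expect_sign]
    simp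

theorem expect_sign_sum_sq {κ : Type*} [Fintype κ] [DecidableEq κ] (a : κ → ℝ) :
    (Finset.expect Finset.univ fun ψ : κ → ℤˣ => (∑ k, ((ψ k : ℤ) : ℝ) * a k) ^ 2) =
      ∑ k, a k ^ 2 := by
  rw [expect_pi_sum_sq fun k (u : ℤˣ) => ((u : ℤ) : ℝ) * a k]
  · exact Finset.sum_congr rfl fun k _ => by rw [expect_sign]; simp
  · intro k
    rw [expect_sign]
    simp

theorem expect_exp_sign_sum_le {κ : Type*} [Fintype κ] [DecidableEq κ] (a : κ → ℝ) :
    (Finset.expect Finset.univ fun ψ : κ → ℤˣ => Real.exp (∑ k, ((ψ k : ℤ) : ℝ) * a k)) ≤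
      Real.exp ((∑ k, a k ^ 2) / 2) := by
  simp_rw [Real.exp_sum]
  rw [expect_pi_prod fun k (u : ℤˣ) => Real.exp (((u : ℤ) : ℝ) * a k), Finset.sum_div,
    Real.exp_sum]
  refine Finset.prod_le_prod (fun k _ => Finset.expect_nonneg fun _ _ => (Real.exp_pos _).le)
    fun k _ => ?_
  rw [expect_sign]
  have h := Real.cosh_le_exp_half_sq (a k)
  rw [Real.cosh_eq] at h
  simpa using h

theorem integrable_exp_neg_sq_add (c : ℝ) :
    MeasureTheory.Integrable fun x : ℝ => Real.exp (-x ^ 2 + c * x) := by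
  have h := ((integrable_exp_neg_mul_sq one_pos).comp_sub_right (c / 2)).const_mul
    (Real.exp (c ^ 2 / 4))
  refine h.congr (Filter.Eventually.of_forall fun x => ?_)
  simp only
  rw [← Real.exp_add]
  congr 1
  ring

theorem integral_exp_neg_sq_add (c : ℝ) :
    ∫ x : ℝ, Real.exp (-x ^ 2 + c * x) = Real.exp (c ^ 2 / 4) * √Real.pi := by
  have h : ∀ x : ℝ, Real.exp (-x ^ 2 + c * x) =
      Real.exp (c ^ 2 / 4) * Real.exp (-1 * (x - c / 2) ^ 2) := fun x => by
    rw [← Real.exp_add]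
    congr 1
    ring
  simp_rw [h]
  rw [MeasureTheory.integral_const_mul,
    MeasureTheory.integral_sub_right_eq_self (fun x : ℝ => Real.exp (-1 * x ^ 2)),
    integral_gaussian, div_one]

/-- A Rademacher sum is sub-Gaussian, so its square has the moment generating function of at most
a scaled `χ²` variable. The square in the exponent is linearised by integrating against a Gaussian,
which makes the signs factorise. -/
theorem expect_exp_mul_sign_sum_sq_le {κ : Type*} [Fintype κ] [DecidableEq κ] (a : κ → ℝ) {t : ℝ}
    (ht : 0 ≤ t) (hta : 2 * (t * ∑ k, a k ^ 2) < 1) :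
    (Finset.expect Finset.univ fun ψ : κ → ℤˣ =>
        Real.exp (t * (∑ k, ((ψ k : ℤ) : ℝ) * a k) ^ 2)) ≤
      (√(1 - 2 * (t * ∑ k, a k ^ 2)))⁻¹ := by
  set τ := ∑ k, a k ^ 2 with hτ
  have hpi : 0 < √Real.pi := Real.sqrt_pos.2 Real.pi_pos
  have lin : ∀ z : ℝ, Real.exp (t * z ^ 2) =
      (√Real.pi)⁻¹ * ∫ x : ℝ, Real.exp (-x ^ 2 + (2 * √t * z) * x) := fun z => by
    rw [integral_exp_neg_sq_add, mul_comm (Real.exp _), inv_mul_cancel_left₀ hpi.ne']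
    congr 1
    rw [mul_pow, mul_pow, Real.sq_sqrt ht]
    ring
  simp_rw [lin]
  rw [← Finset.mul_expect, expect_eq_sum_inv_card_mul]
  simp_rw [← MeasureTheory.integral_const_mul]
  rw [← MeasureTheory.integral_finsetSum _ fun ψ _ => (integrable_exp_neg_sq_add _).const_mul _]
  have hb : 0 < 1 - 2 * (t * τ) := by linarith
  have hle : ∀ x : ℝ, ∑ ψ : κ → ℤˣ, (Fintype.card (κ → ℤˣ) : ℝ)⁻¹ *
      Real.exp (-x ^ 2 + (2 * √t * ∑ k, ((ψ k : ℤ) : ℝ) * a k) * x) ≤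
      Real.exp (-(1 - 2 * (t * τ)) * x ^ 2) := fun x => by
    rw [← expect_eq_sum_inv_card_mul]
    have h1 : ∀ ψ : κ → ℤˣ, Real.exp (-x ^ 2 + (2 * √t * ∑ k, ((ψ k : ℤ) : ℝ) * a k) * x) =
        Real.exp (-x ^ 2) * Real.exp (∑ k, ((ψ k : ℤ) : ℝ) * (2 * √t * x * a k)) := fun ψ => by
      rw [← Real.exp_add, Finset.mul_sum, Finset.sum_mul]
      congr 2
      exact Finset.sum_congr rfl fun k _ => by ring
    simp_rw [h1]
    rw [← Finset.mul_expect]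
    refine (mul_le_mul_of_nonneg_left (expect_exp_sign_sum_le _) (Real.exp_pos _).le).trans_eq ?_
    rw [← Real.exp_add]
    congr 1
    have h2 : ∑ k, (2 * √t * x * a k) ^ 2 = 4 * t * x ^ 2 * τ := by
      rw [hτ, Finset.mul_sum]
      refine Finset.sum_congr rfl fun k _ => ?_
      rw [mul_pow, mul_pow, mul_pow, Real.sq_sqrt ht]
      ring
    rw [h2]
    ring
  have hint := MeasureTheory.integral_mono
    (MeasureTheory.integrable_finsetSum Finset.univ fun (ψ : κ → ℤˣ) _ =>
      (integrable_exp_neg_sq_add (2 * √t * ∑ k, ((ψ k : ℤ) : ℝ) * a k)).const_mul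
        (Fintype.card (κ → ℤˣ) : ℝ)⁻¹)
    (integrable_exp_neg_mul_sq hb) hle
  rw [integral_gaussian, Real.sqrt_div Real.pi_pos.le] at hint
  refine (mul_le_mul_of_nonneg_left hint (inv_pos.2 hpi).le).trans_eq ?_
  field_simp

theorem inv_sqrt_one_sub_le {u : ℝ} (hu : 0 ≤ u) (hu1 : 2 * u < 1) :
    (√(1 - 2 * u))⁻¹ ≤ 1 + u + 3 / 2 * u ^ 2 / (1 - 2 * u) := by
  obtain ⟨r, hr, hr1, hur⟩ : ∃ r : ℝ, 0 < r ∧ r ≤ 1 ∧ √(1 - 2 * u) = r ∧ u = (1 - r ^ 2) / 2 :=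
    ⟨√(1 - 2 * u), Real.sqrt_pos.2 (by linarith), Real.sqrt_le_one.2 (by linarith), rfl, by
      rw [Real.sq_sqrt (by linarith)]; ring⟩
  rw [hur.1, hur.2, show 1 - 2 * ((1 - r ^ 2) / 2) = r ^ 2 by ring, ← sub_nonneg]
  have : 1 + (1 - r ^ 2) / 2 + 3 / 2 * ((1 - r ^ 2) / 2) ^ 2 / r ^ 2 - r⁻¹ =
      (1 - r) ^ 3 * (3 + r) / (8 * r ^ 2) := by
    field_simp
    ring
  rw [this]
  have := pow_nonneg (sub_nonneg.2 hr1) 3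
  positivity

/-! ### The logistic loss -/

theorem hasDerivAt_log_one_add_exp (x : ℝ) :
    HasDerivAt (fun u : ℝ => Real.log (1 + Real.exp u)) (Real.sigmoid x) x := by
  have h := ((Real.hasDerivAt_exp x).const_add 1).log (by positivity)
  convert h using 1
  rw [Real.sigmoid_def, Real.exp_neg]
  have := Real.exp_pos x
  field_simp
  ring

/-- A differentiable function with monotone derivative lies above its tangents. -/
theorem add_mul_sub_le_of_monotone_deriv {f f' : ℝ → ℝ} (hf : ∀ x, HasDerivAt f (f' x) x)
    (hf' : Monotone f') (x y : ℝ) : f x + f' x * (y - x) ≤ f y := by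
  have hcont : Continuous f := continuous_iff_continuousAt.2 fun x => (hf x).continuousAt
  rcases lt_trichotomy x y with h | rfl | h
  · obtain ⟨c, hc, hc'⟩ := exists_hasDerivAt_eq_slope f f' h hcont.continuousOn fun z _ => hf z
    have := hf' hc.1.le
    rw [hc', le_div_iff₀ (by linarith)] at this
    linarith
  · simp
  · obtain ⟨c, hc, hc'⟩ := exists_hasDerivAt_eq_slope f f' h hcont.continuousOn fun z _ => hf z
    have := hf' hc.2.le
    rw [hc', div_le_iff₀ (by linarith)] at this
    linarith

/-- The second derivative of `log (1 + exp u)` is a Bernoulli variance, hence at most `1 / 4`. -/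
theorem log_one_add_exp_le_tangent_add_sq (f u : ℝ) :
    Real.log (1 + Real.exp u) ≤
      Real.log (1 + Real.exp f) + Real.sigmoid f * (u - f) + (u - f) ^ 2 / 8 := by
  have hmono : Monotone fun x : ℝ => x / 4 - Real.sigmoid x := by
    have hd : ∀ x : ℝ, HasDerivAt (fun x : ℝ => x / 4 - Real.sigmoid x)
        (1 / 4 - Real.sigmoid x * (1 - Real.sigmoid x)) x := fun x =>
      ((hasDerivAt_id x).div_const 4).sub (Real.hasDerivAt_sigmoid x)
    refine monotone_of_deriv_nonneg (fun x => (hd x).differentiableAt) fun x => ?_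
    rw [(hd x).deriv]
    nlinarith [sq_nonneg (Real.sigmoid x - 1 / 2)]
  have hd : ∀ x : ℝ, HasDerivAt (fun x : ℝ => x ^ 2 / 8 - Real.log (1 + Real.exp x))
      (x / 4 - Real.sigmoid x) x := fun x => by
    have h := ((hasDerivAt_pow 2 x).div_const 8).sub (hasDerivAt_log_one_add_exp x)
    exact h.congr_deriv (by norm_num; ring)
  have h := add_mul_sub_le_of_monotone_deriv hd hmono f u
  linarith

/-! ### The law of the min-wise hash of a uniform permutation -/

section HashLaw

variable {p : ℕ}

/-- The permutations that send `k` to `m` and all of `z` above `m`. -/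
def permsAbove (k m : Fin p) (z : Finset (Fin p)) : Finset (Equiv.Perm (Fin p)) :=
  Finset.univ.filter fun σ => σ k = m ∧ ∀ j ∈ z, m < σ j

theorem mem_permsAbove {k m : Fin p} {z : Finset (Fin p)} {σ : Equiv.Perm (Fin p)} :
    σ ∈ permsAbove k m z ↔ σ k = m ∧ ∀ j ∈ z, m < σ j := by
  simp [permsAbove]

theorem card_perm_apply_eq (k m : Fin p) :
    (permsAbove k m ∅).card = (p - 1).factorial := by
  have hp : 0 < p := Fin.pos m
  have hconst : ∀ m', (permsAbove k m' ∅).card = (permsAbove k m ∅).card := fun m' => by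
    refine Finset.card_bij' (fun σ _ => Equiv.swap m m' * σ) (fun σ _ => Equiv.swap m m' * σ)
      ?_ ?_ ?_ ?_ <;> simp +contextual [mem_permsAbove, ← mul_assoc]
  have hsum : ∑ m', (permsAbove k m' ∅).card = p.factorial := by
    have h := Finset.card_eq_sum_card_fiberwise (s := Finset.univ) (t := Finset.univ)
      (f := fun σ : Equiv.Perm (Fin p) => σ k) (by simp)
    rw [Finset.card_univ, Fintype.card_perm, Fintype.card_fin] at h
    rw [h]
    exact Finset.sum_congr rfl fun m' _ => by simp [permsAbove]
  simp_rw [hconst, Finset.sum_const, Finset.card_univ, Fintype.card_fin, smul_eq_mul] at hsum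
  rw [← Nat.mul_factorial_pred hp.ne'] at hsum
  exact Nat.eq_of_mul_eq_mul_left hp hsum

theorem card_permsAbove_insert_comm {k m x y : Fin p} {z : Finset (Fin p)}
    (hxk : x ≠ k) (hyk : y ≠ k) (hx : x ∉ z) (hy : y ∉ z) :
    (permsAbove k m (insert x z)).card = (permsAbove k m (insert y z)).card := by
  have key : ∀ x y : Fin p, x ≠ k → y ≠ k → x ∉ z → y ∉ z → ∀ σ ∈ permsAbove k m (insert x z),
      σ * Equiv.swap x y ∈ permsAbove k m (insert y z) := by
    intro x y hxk hyk hx hy σ hσ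
    rw [mem_permsAbove] at hσ ⊢
    refine ⟨by rw [Equiv.Perm.mul_apply, Equiv.swap_apply_of_ne_of_ne hxk.symm hyk.symm, hσ.1],
      fun j hj' => ?_⟩
    rw [Equiv.Perm.mul_apply]
    rcases Finset.mem_insert.1 hj' with rfl | hj
    · rw [Equiv.swap_apply_right]
      exact hσ.2 _ (Finset.mem_insert_self _ _)
    · rw [Equiv.swap_apply_of_ne_of_ne (by rintro rfl; exact hx hj)
        (by rintro rfl; exact hy hj)]
      exact hσ.2 _ (Finset.mem_insert_of_mem hj)
  refine Finset.card_bij' (fun σ _ => σ * Equiv.swap x y) (fun σ _ => σ * Equiv.swap x y)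
    (key x y hxk hyk hx hy) ?_ ?_ ?_
  · rw [Equiv.swap_comm]
    exact key y x hyk hxk hy hx
  · simp [mul_assoc]
  · simp [mul_assoc]

/-- Double counting of the pairs `(σ, y)` with `σ ∈ permsAbove k m (insert y z)`. -/
theorem card_permsAbove_insert_mul {k m x : Fin p} {z : Finset (Fin p)} (hk : k ∉ z) (hxk : x ≠ k)
    (hx : x ∉ z) :
    (permsAbove k m (insert x z)).card * (p - 1 - z.card) =
      (permsAbove k m z).card * (p - 1 - m - z.card) := by
  have hcompl : (insert k z)ᶜ.card = p - 1 - z.card := by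
    rw [Finset.card_compl, Fintype.card_fin, Finset.card_insert_of_notMem hk]
    omega
  have hfib : ∀ σ ∈ permsAbove k m z,
      ((insert k z)ᶜ.filter fun y => m < σ y).card = p - 1 - m - z.card := by
    intro σ hσ
    rw [mem_permsAbove] at hσ
    have h1 : ((insert k z)ᶜ.filter fun y => m < σ y) =
        (Finset.univ.filter fun y => m < σ y) \ z := by
      ext y
      simp only [Finset.mem_filter, Finset.mem_compl, Finset.mem_insert, Finset.mem_sdiff,
        Finset.mem_univ, true_and, not_or]
      constructor
      · rintro ⟨⟨_, h⟩, h'⟩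
        exact ⟨h', h⟩
      · rintro ⟨h, h'⟩
        exact ⟨⟨fun hy => by simp [hy, hσ.1] at h, h'⟩, h⟩
    have h2 : (Finset.univ.filter fun y => m < σ y).card = p - 1 - m := by
      rw [← Fin.card_Ioi m]
      exact Finset.card_equiv σ (by simp)
    rw [h1, Finset.card_sdiff_of_subset, h2]
    intro j hj
    simpa using hσ.2 j hj
  have hcount := Finset.sum_card_bipartiteAbove_eq_sum_card_bipartiteBelow
    (s := permsAbove k m z) (t := (insert k z)ᶜ) fun σ y => m < σ y
  have hcount' := (Finset.sum_congr rfl hfib).symm.trans hcount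
  rw [Finset.sum_const, smul_eq_mul] at hcount'
  rw [hcount', ← hcompl, mul_comm, ← smul_eq_mul, ← Finset.sum_const]
  refine Finset.sum_congr rfl fun y hy => ?_
  simp only [Finset.mem_compl, Finset.mem_insert, not_or] at hy
  rw [card_permsAbove_insert_comm hxk hy.1 hx hy.2]
  congr 1
  ext σ
  simp only [Finset.mem_bipartiteBelow, mem_permsAbove, Finset.forall_mem_insert]
  tauto

/-- Given `σ k = m`, the elements of `z` all land above `m` with probability
`(p - 1 - m)_j / (p - 1)_j`, where `j` is the cardinality of `z` and `(x)_j` the falling factorial. -/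
theorem card_permsAbove_mul (k m : Fin p) (z : Finset (Fin p)) (hk : k ∉ z) :
    (permsAbove k m z).card * (p - 1).descFactorial z.card =
      (p - 1).factorial * (p - 1 - m).descFactorial z.card := by
  induction z using Finset.induction_on with
  | empty => simp [card_perm_apply_eq]
  | insert x z hx ih =>
    rw [Finset.mem_insert, not_or] at hk
    rw [Finset.card_insert_of_notMem hx, Nat.descFactorial_succ, Nat.descFactorial_succ,
      ← mul_assoc, card_permsAbove_insert_mul hk.2 (Ne.symm hk.1) hx, mul_right_comm, ih hk.2]
    ring

theorem argminHash_eq_iff {z : Finset (Fin p)} (hz : z.Nonempty) {k : Fin p} (hk : k ∈ z)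
    (σ : Equiv.Perm (Fin p)) :
    argminHash z hz σ = k ↔ ∀ j ∈ z.erase k, σ k < σ j := by
  constructor
  · rintro rfl j hj
    rw [Finset.mem_erase] at hj
    exact lt_of_le_of_ne (argminHash_le z hz σ j hj.2) fun h => hj.1 (σ.injective h).symm
  · intro h
    by_contra hne
    exact absurd (argminHash_le z hz σ k hk)
      (not_le.2 (h _ (Finset.mem_erase.2 ⟨hne, argminHash_mem z hz σ⟩)))

end HashLaw

/-! ### The weights of the comparator -/

/-- With `q = a + 1` and `p = q + d` this reads `p² ((p-1)_a)² ≤ q (2 p - q) ∑_{j < p} ((j)_a)²` for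
the falling factorials `(j)_a`. Equality holds for `p = q`, and the step from `p` to `p + 1` comes
down to `(p + 1 - q) ^ 2 ≥ 0`. -/
theorem sq_mul_descFactorial_sq_le (a d : ℕ) :
    ((a + 1 + d : ℕ) : ℝ) ^ 2 * (((a + d).descFactorial a : ℕ) : ℝ) ^ 2 ≤
      (∑ j ∈ Finset.range (a + 1 + d), ((j.descFactorial a : ℕ) : ℝ) ^ 2) *
        ((a + 1) * (2 * ((a + 1 + d : ℕ) : ℝ) - (a + 1))) := by
  induction d with
  | zero =>
    have h := Finset.single_le_sum (s := Finset.range (a + 1))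
      (f := fun j => ((j.descFactorial a : ℕ) : ℝ) ^ 2) (fun j _ => sq_nonneg _)
      (Finset.self_mem_range_succ a)
    have h2 := mul_le_mul_of_nonneg_left h (sq_nonneg ((a : ℝ) + 1))
    simp only [add_zero]
    push_cast
    nlinarith
  | succ d ih =>
    have hrec : ((a + 1 + d).descFactorial a : ℝ) * (d + 1) =
        (a + 1 + d) * ((a + d).descFactorial a : ℝ) := by
      have h := Nat.succ_descFactorial (a + d) a
      rw [show a + d + 1 - a = d + 1 by omega, show a + d + 1 = a + 1 + d by omega] at h
      have h' : ((d + 1 : ℕ) : ℝ) * ((a + 1 + d).descFactorial a : ℝ) =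
          ((a + 1 + d : ℕ) : ℝ) * ((a + d).descFactorial a : ℝ) := by exact_mod_cast h
      push_cast at h'
      linarith
    rw [show a + 1 + (d + 1) = a + 1 + d + 1 by ring, Finset.sum_range_succ,
      show a + (d + 1) = a + 1 + d by ring]
    set S := ∑ j ∈ Finset.range (a + 1 + d), ((j.descFactorial a : ℕ) : ℝ) ^ 2
    set x := ((a + 1 + d).descFactorial a : ℝ)
    set y := ((a + d).descFactorial a : ℝ)
    push_cast at ih ⊢
    have ha : (0 : ℝ) ≤ a := Nat.cast_nonneg a
    have hd : (0 : ℝ) ≤ d := Nat.cast_nonneg d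
    set A : ℝ := a + 1 with hA
    have hA1 : 1 ≤ A := by linarith
    -- `x² (d+1)² = (A+d)² y²` turns the induction hypothesis into a bound for `S` in terms of `x²`.
    have e : (A + d) ^ 2 * y ^ 2 = x ^ 2 * (d + 1) ^ 2 := by
      rw [← mul_pow, ← mul_pow, hrec]
    rw [e] at ih
    have hpos : 0 < A + 2 * d := by linarith
    have hS : x ^ 2 * (d + 1) ^ 2 / (A * (A + 2 * d)) ≤ S := by
      rw [div_le_iff₀ (by positivity)]
      linarith
    have goal : (A + d + 1) ^ 2 * x ^ 2 ≤
        (x ^ 2 * (d + 1) ^ 2 / (A * (A + 2 * d)) + x ^ 2) * (A * (2 * (A + d + 1) - A)) := by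
      have : (x ^ 2 * (d + 1) ^ 2 / (A * (A + 2 * d)) + x ^ 2) * (A * (2 * (A + d + 1) - A)) -
          (A + d + 1) ^ 2 * x ^ 2 = x ^ 2 * (2 * (d + 1) ^ 2) / (A + 2 * d) := by
        field_simp
        ring
      have h3 : 0 ≤ x ^ 2 * (2 * ((d : ℝ) + 1) ^ 2) / (A + 2 * d) := by positivity
      linarith
    refine goal.trans (mul_le_mul_of_nonneg_right (by linarith) ?_)
    have : 0 ≤ 2 * (A + d + 1) - A := by linarith
    positivity

/-- There are weights `w` for which `w (σ k)`, restricted to the event that `k` is the hashed index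
of a given `q`-set containing `k`, has mean one, while `w` has second moment and maximum at most
`(2 - q / p) q`. They are proportional to the probability that the minimum of a `q`-set is attained
at a given element with a given value, which minimises the second moment. -/
theorem exists_hash_weights {p q : ℕ} (hq : 1 ≤ q) (hqp : q ≤ p) :
    ∃ w : Fin p → ℝ, (∀ m, 0 ≤ w m ∧ w m ≤ (2 - (q : ℝ) / p) * q) ∧
      (Finset.expect Finset.univ fun m => w m ^ 2) ≤ (2 - (q : ℝ) / p) * q ∧
      ∀ (z : Finset (Fin p)) (hz : z.Nonempty), z.card = q → ∀ k ∈ z,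
        (Finset.expect Finset.univ fun σ : Equiv.Perm (Fin p) =>
          if argminHash z hz σ = k then w (σ k) else 0) = 1 := by
  have hp : 0 < p := by omega
  have hp' : (0 : ℝ) < p := by exact_mod_cast hp
  set V : ℝ := (2 - (q : ℝ) / p) * q with hV
  set δ : Fin p → ℝ := fun m => (((p - 1 - m).descFactorial (q - 1) : ℕ) : ℝ) with hδ
  set δ₀ : ℝ := (((p - 1).descFactorial (q - 1) : ℕ) : ℝ) with hδ₀
  set D : ℝ := ∑ m, δ m ^ 2 with hD
  have hδ₀pos : 0 < δ₀ := by
    rw [hδ₀]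
    exact_mod_cast Nat.descFactorial_pos.2 (by omega)
  have hδ_nonneg : ∀ m, 0 ≤ δ m := fun m => Nat.cast_nonneg _
  have hδ_le : ∀ m, δ m ≤ δ₀ := fun m => by
    simp only [hδ, hδ₀]
    exact_mod_cast Nat.descFactorial_le _ (Nat.sub_le _ _)
  have hD_eq : D = ∑ j ∈ Finset.range p, ((j.descFactorial (q - 1) : ℕ) : ℝ) ^ 2 := by
    rw [← Finset.sum_range_reflect, hD, Finset.sum_range]
  have hDV : p * δ₀ ^ 2 ≤ V * D := by
    obtain ⟨a, rfl⟩ : ∃ a, q = a + 1 := ⟨q - 1, by omega⟩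
    obtain ⟨d, rfl⟩ : ∃ d, p = a + 1 + d := ⟨p - (a + 1), by omega⟩
    have h := sq_mul_descFactorial_sq_le a d
    rw [hD_eq, hV, hδ₀, show a + 1 + d - 1 = a + d by omega, Nat.add_sub_cancel]
    set S := ∑ j ∈ Finset.range (a + 1 + d), ((j.descFactorial a : ℕ) : ℝ) ^ 2
    rw [show (2 - ((a + 1 : ℕ) : ℝ) / ((a + 1 + d : ℕ) : ℝ)) * ((a + 1 : ℕ) : ℝ) * S =
      S * ((a + 1) * (2 * ((a + 1 + d : ℕ) : ℝ) - (a + 1))) / ((a + 1 + d : ℕ) : ℝ) by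
        field_simp
        push_cast
        ring, le_div_iff₀ hp']
    linarith
  have hDpos : 0 < D := by
    have h := Finset.single_le_sum (f := fun m => δ m ^ 2) (fun m _ => sq_nonneg _)
      (Finset.mem_univ (⟨0, hp⟩ : Fin p))
    have h0 : δ ⟨0, hp⟩ = δ₀ := by simp [hδ, hδ₀]
    simp only [h0] at h
    exact (pow_pos hδ₀pos 2).trans_le h
  refine ⟨fun m => p * δ₀ * δ m / D, fun m => ⟨?_, ?_⟩, ?_, ?_⟩
  · have := hδ_nonneg m
    positivity
  · rw [div_le_iff₀ hDpos]
    refine le_trans ?_ hDV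
    rw [sq, ← mul_assoc]
    exact mul_le_mul_of_nonneg_left (hδ_le m) (by positivity)
  · rw [Fintype.expect_eq_sum_div_card, Fintype.card_fin]
    have : ∑ m, (p * δ₀ * δ m / D) ^ 2 = (p * δ₀) ^ 2 / D := by
      simp_rw [div_pow, mul_pow _ (δ _)]
      rw [← Finset.sum_div, ← Finset.mul_sum, ← hD]
      field_simp
    rw [this, div_div, div_le_iff₀ (by positivity)]
    nlinarith
  · intro z hz hzq k hk
    have hcard : ∀ m, ((permsAbove k m (z.erase k)).card : ℝ) * δ₀ = (p - 1).factorial * δ m := by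
      intro m
      have h := card_permsAbove_mul k m (z.erase k) (Finset.notMem_erase _ _)
      rw [Finset.card_erase_of_mem hk, hzq] at h
      simp only [hδ, hδ₀]
      exact_mod_cast h
    have hsum : ∑ σ : Equiv.Perm (Fin p), (if argminHash z hz σ = k then
        p * δ₀ * δ (σ k) / D else 0) =
        ∑ m, ((permsAbove k m (z.erase k)).card : ℝ) * (p * δ₀ * δ m / D) := by
      rw [← Finset.sum_fiberwise (g := fun σ : Equiv.Perm (Fin p) => σ k)]
      refine Finset.sum_congr rfl fun m _ => ?_
      rw [← Finset.sum_filter, Finset.filter_filter, ← nsmul_eq_mul (permsAbove _ _ _).card,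
        ← Finset.sum_const]
      refine Finset.sum_congr ?_ ?_
      · ext σ
        simp only [Finset.mem_filter, Finset.mem_univ, true_and, mem_permsAbove,
          argminHash_eq_iff hz hk]
        constructor <;> rintro ⟨rfl, h⟩ <;> exact ⟨rfl, h⟩
      · intro σ hσ
        rw [(mem_permsAbove.1 hσ).1]
    rw [Fintype.expect_eq_sum_div_card, hsum, Fintype.card_perm, Fintype.card_fin]
    have hterm : ∀ m, ((permsAbove k m (z.erase k)).card : ℝ) * (p * δ₀ * δ m / D) =
        p * (p - 1).factorial / D * δ m ^ 2 := fun m => by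
      rw [show ((permsAbove k m (z.erase k)).card : ℝ) * (p * δ₀ * δ m / D) =
        ((permsAbove k m (z.erase k)).card : ℝ) * δ₀ * (p * δ m / D) by ring, hcard]
      ring
    simp_rw [hterm]
    rw [← Finset.mul_sum, ← hD, div_mul_cancel₀ _ hDpos.ne', ← Nat.mul_factorial_pred hp.ne']
    push_cast
    exact div_self (by positivity)

/-! ### One copy of the hash -/

section OneCopy

variable {p : ℕ}

/-- The value of one copy of the hash in row `i`, as a function of the permutation and of the
signs: an entry of a column of `hashedMatrix`. -/
noncomputable def hashedEntry {n : ℕ} (X : Matrix (Fin n) (Fin p) ℝ) (i : Fin n)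
    (ω : Equiv.Perm (Fin p) × (Fin p → ℤˣ)) : ℝ :=
  open Classical in
  if hz : (rowSupport X i).Nonempty then
    ((ω.2 (argminHash (rowSupport X i) hz ω.1) : ℤ) : ℝ) *
      X i (argminHash (rowSupport X i) hz ω.1)
  else 0

/-- The sum `∑ₖ ψₖ βₖ w (σ k)`, which is `L` times a coordinate of the comparator. -/
noncomputable def weightedSignSum (w β : Fin p → ℝ) (ω : Equiv.Perm (Fin p) × (Fin p → ℤˣ)) : ℝ :=
  ∑ k, ((ω.2 k : ℤ) : ℝ) * (β k * w (ω.1 k))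

theorem expect_prod {α α' : Type*} [Fintype α] [Fintype α'] (f : α × α' → ℝ) :
    Finset.expect Finset.univ f =
      Finset.expect Finset.univ fun x => Finset.expect Finset.univ fun y => f (x, y) := by
  rw [← Finset.univ_product_univ, Finset.expect_product]

theorem expect_perm_apply (k : Fin p) (g : Fin p → ℝ) :
    (Finset.expect Finset.univ fun σ : Equiv.Perm (Fin p) => g (σ k)) =
      Finset.expect Finset.univ g := by
  have hp : 0 < p := Fin.pos k
  rw [Fintype.expect_eq_sum_div_card, Fintype.expect_eq_sum_div_card, Fintype.card_perm,
    Fintype.card_fin, ← Finset.sum_fiberwise (g := fun σ : Equiv.Perm (Fin p) => σ k)]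
  have h : ∀ m, ∑ σ : Equiv.Perm (Fin p) with σ k = m, g (σ k) = (p - 1).factorial * g m := by
    intro m
    rw [← card_perm_apply_eq k m, ← nsmul_eq_mul (permsAbove k m ∅).card, ← Finset.sum_const]
    refine Finset.sum_congr (by simp [permsAbove]) fun σ hσ => ?_
    rw [(mem_permsAbove.1 hσ).1]
  simp_rw [h]
  rw [← Finset.mul_sum, ← Nat.mul_factorial_pred hp.ne']
  push_cast
  have : ((p - 1).factorial : ℝ) ≠ 0 := by exact_mod_cast Nat.factorial_ne_zero _
  field_simp

variable {w : Fin p → ℝ} {V : ℝ}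

theorem expect_perm_sum_sq_le (hw2 : (Finset.expect Finset.univ fun m => w m ^ 2) ≤ V)
    (β : Fin p → ℝ) :
    (Finset.expect Finset.univ fun σ : Equiv.Perm (Fin p) => ∑ k, (β k * w (σ k)) ^ 2) ≤
      V * ∑ k, β k ^ 2 := by
  rw [Finset.expect_sum_comm, Finset.mul_sum]
  refine Finset.sum_le_sum fun k _ => ?_
  simp_rw [mul_pow]
  rw [← Finset.mul_expect, expect_perm_apply k fun m => w m ^ 2, mul_comm V]
  exact mul_le_mul_of_nonneg_left hw2 (sq_nonneg _)

theorem expect_weightedSignSum_sq_le (hw2 : (Finset.expect Finset.univ fun m => w m ^ 2) ≤ V)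
    (β : Fin p → ℝ) :
    (Finset.expect Finset.univ fun ω => weightedSignSum w β ω ^ 2) ≤ V * ∑ k, β k ^ 2 := by
  rw [expect_prod]
  simp only [weightedSignSum]
  simp_rw [expect_sign_sum_sq]
  exact expect_perm_sum_sq_le hw2 β

theorem hashedEntry_sq_le_one {n : ℕ} {X : Matrix (Fin n) (Fin p) ℝ} (hX : ∀ i k, |X i k| ≤ 1)
    (i : Fin n) (ω : Equiv.Perm (Fin p) × (Fin p → ℤˣ)) : hashedEntry X i ω ^ 2 ≤ 1 := by
  unfold hashedEntry
  split_ifs with hz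
  · rw [mul_pow, sq, sign_mul_self, one_mul, sq_le_one_iff_abs_le_one]
    exact hX _ _
  · norm_num

/-- The comparator is unbiased: averaging over the signs leaves only the term of the hashed index,
and the weights are chosen so that every index of the row then has total weight one. -/
theorem expect_hashedEntry_mul_weightedSignSum {n q : ℕ} {X : Matrix (Fin n) (Fin p) ℝ}
    (hq : 1 ≤ q)
    (hw : ∀ (z : Finset (Fin p)) (hz : z.Nonempty), z.card = q → ∀ k ∈ z,
        (Finset.expect Finset.univ fun σ : Equiv.Perm (Fin p) =>
          if argminHash z hz σ = k then w (σ k) else 0) = 1)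
    {i : Fin n} (hXq : (rowSupport X i).card = q) (β : Fin p → ℝ) :
    (Finset.expect Finset.univ fun ω => hashedEntry X i ω * weightedSignSum w β ω) =
      ∑ k, X i k * β k := by
  have hz : (rowSupport X i).Nonempty := Finset.card_pos.1 (by omega)
  rw [expect_prod]
  have hψ : ∀ σ : Equiv.Perm (Fin p), (Finset.expect Finset.univ fun ψ : Fin p → ℤˣ =>
      hashedEntry X i (σ, ψ) * weightedSignSum w β (σ, ψ)) =
      ∑ k ∈ rowSupport X i, X i k * β k *
        if argminHash (rowSupport X i) hz σ = k then w (σ k) else 0 := by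
    intro σ
    set h := argminHash (rowSupport X i) hz σ with hh
    have hmem : h ∈ rowSupport X i := argminHash_mem _ hz σ
    have e1 : ∀ ψ : Fin p → ℤˣ, hashedEntry X i (σ, ψ) * weightedSignSum w β (σ, ψ) =
        ∑ k, X i h * (β k * w (σ k)) * (((ψ h : ℤ) : ℝ) * ((ψ k : ℤ) : ℝ)) := fun ψ => by
      simp only [hashedEntry, weightedSignSum, dif_pos hz]
      rw [Finset.mul_sum]
      exact Finset.sum_congr rfl fun k _ => by ring
    simp_rw [e1]
    rw [Finset.expect_sum_comm]
    simp_rw [← Finset.mul_expect, expect_sign_mul_sign, mul_ite, mul_one, mul_zero]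
    rw [Finset.sum_ite_eq, Finset.sum_ite_eq, if_pos (Finset.mem_univ _), if_pos hmem]
    ring
  simp_rw [hψ]
  rw [Finset.expect_sum_comm]
  simp_rw [← Finset.mul_expect]
  rw [Finset.sum_congr rfl fun k hk => by rw [hw _ hz hXq k hk, mul_one]]
  refine Finset.sum_subset (Finset.subset_univ _) fun k _ hk => ?_
  have : X i k = 0 := by simpa [rowSupport] using hk
  rw [this, zero_mul]

/-- The conditional variance of the sum given the permutation is at most `V ^ 2 * ∑ k, β k ^ 2`
and has mean at most `V * ∑ k, β k ^ 2`; the quadratic term is bounded by one factor of each. -/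
theorem expect_exp_weightedSignSum_sq_le (hw : ∀ m, 0 ≤ w m ∧ w m ≤ V)
    (hw2 : (Finset.expect Finset.univ fun m => w m ^ 2) ≤ V) (β : Fin p → ℝ) {t : ℝ} (ht : 0 ≤ t)
    (ht1 : 2 * (t * (V ^ 2 * ∑ k, β k ^ 2)) < 1) :
    (Finset.expect Finset.univ fun ω => Real.exp (t * weightedSignSum w β ω ^ 2)) ≤
      1 + t * (V * ∑ k, β k ^ 2) *
        (1 + 3 / 2 * (t * (V ^ 2 * ∑ k, β k ^ 2)) / (1 - 2 * (t * (V ^ 2 * ∑ k, β k ^ 2)))) := by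
  set N := ∑ k, β k ^ 2 with hN
  set s := t * (V ^ 2 * N) with hs
  have hN0 : 0 ≤ N := Finset.sum_nonneg fun k _ => sq_nonneg _
  have hs0 : 0 ≤ s := by positivity
  have hs1 : 0 < 1 - 2 * s := by linarith
  rw [expect_prod]
  set τ : Equiv.Perm (Fin p) → ℝ := fun σ => ∑ k, (β k * w (σ k)) ^ 2 with hτ
  have hτ0 : ∀ σ, 0 ≤ τ σ := fun σ => Finset.sum_nonneg fun k _ => sq_nonneg _
  have hτ1 : ∀ σ, τ σ ≤ V ^ 2 * N := fun σ => by
    rw [hτ, hN, Finset.mul_sum]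
    refine Finset.sum_le_sum fun k _ => ?_
    rw [mul_pow, mul_comm]
    exact mul_le_mul_of_nonneg_right (pow_le_pow_left₀ (hw _).1 (hw _).2 2) (sq_nonneg _)
  have hψ : ∀ σ, (Finset.expect Finset.univ fun ψ : Fin p → ℤˣ =>
      Real.exp (t * weightedSignSum w β (σ, ψ) ^ 2)) ≤
      1 + t * τ σ * (1 + 3 / 2 * s / (1 - 2 * s)) := by
    intro σ
    have hu0 : 0 ≤ t * τ σ := mul_nonneg ht (hτ0 σ)
    have hus : t * τ σ ≤ s := mul_le_mul_of_nonneg_left (hτ1 σ) ht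
    refine (expect_exp_mul_sign_sum_sq_le (fun k => β k * w (σ k)) ht ?_).trans
      ((inv_sqrt_one_sub_le hu0 ?_).trans ?_)
    · change 2 * (t * τ σ) < 1
      linarith
    · linarith
    · have : 3 / 2 * (t * τ σ) ^ 2 / (1 - 2 * (t * τ σ)) ≤
          t * τ σ * (3 / 2 * s) / (1 - 2 * s) := by
        refine div_le_div₀ (by positivity) ?_ hs1 (by linarith)
        nlinarith
      rw [mul_div_assoc (t * τ σ)] at this
      linarith
  have hC : 0 ≤ t * (1 + 3 / 2 * s / (1 - 2 * s)) := by positivity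
  refine (Finset.expect_le_expect fun σ _ => hψ σ).trans ?_
  rw [Finset.expect_add_distrib, Fintype.expect_const]
  have hlin : ∀ σ, t * τ σ * (1 + 3 / 2 * s / (1 - 2 * s)) =
      t * (1 + 3 / 2 * s / (1 - 2 * s)) * τ σ := fun σ => by ring
  simp_rw [hlin]
  rw [← Finset.mul_expect]
  have := mul_le_mul_of_nonneg_left (expect_perm_sum_sq_le hw2 β) hC
  linarith

end OneCopy

/-! ### Independent copies of the hash -/

section Copies

variable {p L : ℕ} {w : Fin p → ℝ} {V : ℝ}

/-- Bernstein's inequality for the squared norm of the comparator. -/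
theorem expect_norm_gt_le (hL : 1 ≤ L) (hV : 0 < V) (hw : ∀ m, 0 ≤ w m ∧ w m ≤ V)
    (hw2 : (Finset.expect Finset.univ fun m => w m ^ 2) ≤ V) (β : Fin p → ℝ) {η : ℝ}
    (hη : 0 ≤ η) :
    (Finset.expect Finset.univ fun ω : Fin L → Equiv.Perm (Fin p) × (Fin p → ℤˣ) =>
      if (1 + η) * (V * (∑ k, β k ^ 2) / L) < ∑ l, (weightedSignSum w β (ω l) / L) ^ 2
        then (1 : ℝ) else 0) ≤ Real.exp (-(L * η ^ 2 / (2 * V * (3 + 2 * η)))) := by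
  have hL' : (0 : ℝ) < L := by exact_mod_cast hL
  have hN0 : 0 ≤ ∑ k, β k ^ 2 := Finset.sum_nonneg fun k _ => sq_nonneg _
  rcases hN0.eq_or_lt with hN | hN
  · have hβ : ∀ k, β k = 0 := fun k => by
      have := (Finset.sum_eq_zero_iff_of_nonneg fun k _ => sq_nonneg (β k)).1 hN.symm k
        (Finset.mem_univ k)
      simpa using this
    simp [weightedSignSum, hβ, Real.exp_nonneg]
  set N := ∑ k, β k ^ 2
  -- The exponent is Bernstein's: the deviation over `variance factor + scale * deviation`.
  set t : ℝ := η / (V ^ 2 * N * (3 + 2 * η)) with ht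
  have ht0 : 0 ≤ t := by positivity
  have hs : t * (V ^ 2 * N) = η / (3 + 2 * η) := by
    rw [ht]
    field_simp
  have hs1 : 1 - 2 * (η / (3 + 2 * η)) = 3 / (3 + 2 * η) := by
    field_simp
    ring
  have hone : (Finset.expect Finset.univ fun ω => Real.exp (t * weightedSignSum w β ω ^ 2)) ≤
      Real.exp (t * (V * N) * (1 + η / 2)) := by
    refine (expect_exp_weightedSignSum_sq_le hw hw2 β ht0 ?_).trans ?_
    · rw [hs]
      have : 0 < 3 / (3 + 2 * η) := by positivity
      linarith
    · rw [hs, hs1, add_comm]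
      refine le_trans (le_of_eq ?_) (Real.add_one_le_exp _)
      congr 2
      field_simp
  have hind : ∀ ω : Fin L → Equiv.Perm (Fin p) × (Fin p → ℤˣ),
      (if (1 + η) * (V * N / L) < ∑ l, (weightedSignSum w β (ω l) / L) ^ 2
        then (1 : ℝ) else 0) ≤
      Real.exp (-(t * ((1 + η) * (V * N) * L))) *
        ∏ l, Real.exp (t * weightedSignSum w β (ω l) ^ 2) := by
    intro ω
    rw [← Real.exp_sum, ← Real.exp_add, ← Finset.mul_sum]
    split_ifs with h
    · refine Real.one_le_exp ?_
      simp_rw [div_pow] at h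
      rw [← Finset.sum_div, lt_div_iff₀ (by positivity)] at h
      have h' : (1 + η) * (V * N) * L ≤ ∑ l, weightedSignSum w β (ω l) ^ 2 := by
        refine le_of_eq_of_le ?_ h.le
        field_simp
      have := mul_le_mul_of_nonneg_left h' ht0
      linarith
    · exact (Real.exp_pos _).le
  refine (Finset.expect_le_expect fun ω _ => hind ω).trans ?_
  rw [← Finset.mul_expect,
    expect_pi_prod fun (_ : Fin L) x => Real.exp (t * weightedSignSum w β x ^ 2),
    Finset.prod_const, Finset.card_univ, Fintype.card_fin]
  refine (mul_le_mul_of_nonneg_left (pow_le_pow_left₀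
    (Finset.expect_nonneg fun _ _ => (Real.exp_pos _).le) hone L) (Real.exp_pos _).le).trans_eq ?_
  rw [← Real.exp_nat_mul, ← Real.exp_add]
  congr 1
  rw [ht]
  field_simp
  ring

/-- The prediction `(S b*)ᵢ` of the comparator has mean `∑ k, X i k * β k`, and as an average of
`L` independent copies it has a variance of order `1 / L`. -/
theorem expect_comparator_sub_sq_le {n q : ℕ} {X : Matrix (Fin n) (Fin p) ℝ} (hL : 1 ≤ L)
    (hq : 1 ≤ q) (hX : ∀ i k, |X i k| ≤ 1)
    (hw2 : (Finset.expect Finset.univ fun m => w m ^ 2) ≤ V)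
    (hw : ∀ (z : Finset (Fin p)) (hz : z.Nonempty), z.card = q → ∀ k ∈ z,
        (Finset.expect Finset.univ fun σ : Equiv.Perm (Fin p) =>
          if argminHash z hz σ = k then w (σ k) else 0) = 1)
    {i : Fin n} (hXq : (rowSupport X i).card = q) (β : Fin p → ℝ) :
    (Finset.expect Finset.univ fun ω : Fin L → Equiv.Perm (Fin p) × (Fin p → ℤˣ) =>
      (∑ l, hashedEntry X i (ω l) * (weightedSignSum w β (ω l) / L) -
        ∑ k, X i k * β k) ^ 2) ≤ V * (∑ k, β k ^ 2) / L := by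
  have hL' : (0 : ℝ) < L := by exact_mod_cast hL
  set μ := ∑ k, X i k * β k with hμ
  set T : Equiv.Perm (Fin p) × (Fin p → ℤˣ) → ℝ :=
    fun x => hashedEntry X i x * weightedSignSum w β x with hT
  have hmean : Finset.expect Finset.univ T = μ :=
    expect_hashedEntry_mul_weightedSignSum hq hw hXq β
  have e : ∀ ω : Fin L → Equiv.Perm (Fin p) × (Fin p → ℤˣ),
      (∑ l, hashedEntry X i (ω l) * (weightedSignSum w β (ω l) / L) - μ) ^ 2 =
        (1 / (L : ℝ) ^ 2) * (∑ l, (T (ω l) - μ)) ^ 2 := by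
    intro ω
    rw [Finset.sum_sub_distrib, Finset.sum_const, Finset.card_univ, Fintype.card_fin,
      nsmul_eq_mul]
    simp_rw [← mul_div_assoc]
    rw [← Finset.sum_div]
    field_simp
    rfl
  simp_rw [e]
  rw [← Finset.mul_expect, expect_pi_sum_sq fun (_ : Fin L) x => T x - μ]
  · rw [Finset.sum_const, Finset.card_univ, Fintype.card_fin, nsmul_eq_mul]
    have hvar : (Finset.expect Finset.univ fun x => (T x - μ) ^ 2) ≤ V * ∑ k, β k ^ 2 := by
      have h1 : ∀ x, (T x - μ) ^ 2 = T x ^ 2 - 2 * μ * T x + μ ^ 2 := fun x => by ring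
      simp_rw [h1]
      rw [Finset.expect_add_distrib, Finset.expect_sub_distrib, ← Finset.mul_expect, hmean,
        Fintype.expect_const]
      have h2 : (Finset.expect Finset.univ fun x => T x ^ 2) ≤ V * ∑ k, β k ^ 2 := by
        refine (Finset.expect_le_expect fun x _ => ?_).trans (expect_weightedSignSum_sq_le hw2 β)
        rw [hT]
        simp only
        rw [mul_pow]
        exact mul_le_of_le_one_left (sq_nonneg _) (hashedEntry_sq_le_one hX i x)
      nlinarith [sq_nonneg μ]
    rw [← mul_assoc, show 1 / (L : ℝ) ^ 2 * L = 1 / L by field_simp, one_div_mul_eq_div]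
    exact div_le_div_of_nonneg_right hvar hL'.le
  · intro _
    rw [Finset.expect_sub_distrib, hmean, Fintype.expect_const, sub_self]

/-- The `L` permutations and the sign matrix, taken together, are `L` independent copies of a
permutation with a vector of signs. -/
theorem expect_expect_eq_expect_copies
    (F : (Fin L → Equiv.Perm (Fin p)) → Matrix (Fin p) (Fin L) ℤˣ → ℝ) :
    (Finset.expect Finset.univ fun π => Finset.expect Finset.univ fun Ψ : Fin p → Fin L → ℤˣ =>
      F π (Matrix.of Ψ)) =
    Finset.expect Finset.univ fun ω : Fin L → Equiv.Perm (Fin p) × (Fin p → ℤˣ) =>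
      F (fun l => (ω l).1) (Matrix.of fun k l => (ω l).2 k) := by
  rw [← expect_prod fun x : (Fin L → Equiv.Perm (Fin p)) × (Fin p → Fin L → ℤˣ) =>
    F x.1 (Matrix.of x.2)]
  let e : (Fin L → Equiv.Perm (Fin p)) × (Fin p → Fin L → ℤˣ) ≃
      (Fin L → Equiv.Perm (Fin p) × (Fin p → ℤˣ)) :=
    { toFun := fun x l => (x.1 l, fun k => x.2 k l)
      invFun := fun ω => (fun l => (ω l).1, fun k l => (ω l).2 k)
      left_inv := fun _ => rfl
      right_inv := fun _ => rfl }
  exact Fintype.expect_equiv e _ _ fun _ => rfl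

end Copies

/-! ### Logistic risk -/

section Risk

variable {n L : ℕ}

theorem eq_sigmoid_of_log_odds {x f : ℝ} (hx : 0 < x ∧ x < 1) (h : Real.log (x / (1 - x)) = f) :
    x = Real.sigmoid f := by
  have h1 : 0 < 1 - x := by linarith [hx.2]
  have h0 := hx.1
  rw [Real.sigmoid_def, ← h, Real.exp_neg, Real.exp_log (div_pos hx.1 h1)]
  field_simp
  ring

theorem pTilde_le_quarter (hn : 1 ≤ n) (P : Fin n → ℝ) : pTilde P ≤ 1 / 4 := by
  have hn' : (0 : ℝ) < n := by exact_mod_cast hn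
  have h : ∑ i, P i * (1 - P i) ≤ ∑ _i : Fin n, (1 / 4 : ℝ) :=
    Finset.sum_le_sum fun i _ => by nlinarith [sq_nonneg (P i - 1 / 2)]
  rw [Finset.sum_const, Finset.card_univ, Fintype.card_fin, nsmul_eq_mul] at h
  rw [pTilde, one_div_mul_eq_div, div_le_iff₀ hn']
  linarith

theorem logisticRisk_sigmoid_nonneg (f : Fin n → ℝ) :
    0 ≤ logisticRisk (fun i => Real.sigmoid (f i)) f := by
  refine mul_nonneg (by positivity) (Finset.sum_nonneg fun i _ => ?_)
  -- The summand is the convex combination `(1 - σ) * log (1 + exp f) + σ * (log (1 + exp f) - f)`.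
  have h0 := Real.sigmoid_nonneg (f i)
  have h1 := Real.sigmoid_le_one (f i)
  have ha : 0 ≤ Real.log (1 + Real.exp (f i)) :=
    Real.log_nonneg (by linarith [Real.exp_pos (f i)])
  have hb : f i ≤ Real.log (1 + Real.exp (f i)) := by
    rw [Real.le_log_iff_exp_le (by positivity)]
    linarith
  nlinarith

theorem logisticRisk_zero (hn : 1 ≤ n) (t : Fin n → ℝ) : logisticRisk t 0 = Real.log 2 := by
  have hn' : (0 : ℝ) < n := by exact_mod_cast hn
  simp only [logisticRisk, Pi.zero_apply, mul_zero, neg_zero, Real.exp_zero, zero_add,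
    Finset.sum_const, Finset.card_univ, Fintype.card_fin, nsmul_eq_mul]
  norm_num
  field_simp

theorem logisticRisk_sub_le (f u : Fin n → ℝ) :
    logisticRisk (fun i => Real.sigmoid (f i)) u - logisticRisk (fun i => Real.sigmoid (f i)) f ≤
      1 / (n : ℝ) * ∑ i, (u i - f i) ^ 2 / 8 := by
  rw [logisticRisk, logisticRisk, ← mul_sub, ← Finset.sum_sub_distrib]
  refine mul_le_mul_of_nonneg_left (Finset.sum_le_sum fun i _ => ?_) (by positivity)
  linarith [log_one_add_exp_le_tangent_add_sq (f i) (u i)]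

theorem logisticRisk_eq_add (t t' u : Fin n → ℝ) :
    logisticRisk t u = logisticRisk t' u + 1 / (n : ℝ) * ∑ i, (t' i - t i) * u i := by
  rw [logisticRisk, logisticRisk, ← mul_add, ← Finset.sum_add_distrib]
  congr 1
  exact Finset.sum_congr rfl fun i _ => by ring

/-! ### Bernoulli labels -/

/-- The Bernoulli weights, of which `labelProb` is the product. -/
noncomputable def bernoulliWeight (P : Fin n → ℝ) (i : Fin n) (b : Bool) : ℝ :=
  if b then P i else 1 - P i

theorem labelProb_eq_prod (P : Fin n → ℝ) (y : Fin n → Bool) :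
    labelProb P y = ∏ i, bernoulliWeight P i (y i) := rfl

theorem labelProb_nonneg {P : Fin n → ℝ} (hP : ∀ i, 0 < P i ∧ P i < 1) (y : Fin n → Bool) :
    0 ≤ labelProb P y :=
  Finset.prod_nonneg fun i _ => by
    split_ifs
    · exact (hP i).1.le
    · linarith [(hP i).2]

theorem sum_bernoulliWeight (P : Fin n → ℝ) (i : Fin n) : ∑ b, bernoulliWeight P i b = 1 := by
  simp [bernoulliWeight]

theorem sum_labelProb (P : Fin n → ℝ) : ∑ y, labelProb P y = 1 :=
  sum_prod_eq_one _ (sum_bernoulliWeight P)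

theorem sum_labelProb_mul_noise (P : Fin n → ℝ) (i : Fin n) :
    ∑ y, labelProb P y * (labelValue (y i) - P i) = 0 := by
  have h := sum_prod_mul_apply (bernoulliWeight P) (sum_bernoulliWeight P) i
    fun b => labelValue b - P i
  simp_rw [labelProb_eq_prod, h]
  simp [bernoulliWeight, labelValue]
  ring

theorem sum_labelProb_mul_sum_noise_sq (P c : Fin n → ℝ) :
    ∑ y, labelProb P y * (∑ i, c i * (labelValue (y i) - P i)) ^ 2 =
      ∑ i, c i ^ 2 * (P i * (1 - P i)) := by
  have h := sum_prod_mul_sum_sq (bernoulliWeight P) (fun i b => c i * (labelValue b - P i))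
    (sum_bernoulliWeight P) fun i => by
      simp [bernoulliWeight, labelValue]
      ring
  simp_rw [labelProb_eq_prod, h]
  refine Finset.sum_congr rfl fun i _ => ?_
  simp [bernoulliWeight, labelValue]
  ring

theorem sum_labelProb_mul_sqrt_le {P : Fin n → ℝ} (hP : ∀ i, 0 < P i ∧ P i < 1)
    {g : (Fin n → Bool) → ℝ} (hg : ∀ y, 0 ≤ g y) :
    ∑ y, labelProb P y * √(g y) ≤ √(∑ y, labelProb P y * g y) := by
  refine Real.le_sqrt_of_sq_le ?_
  have h := Real.pow_arith_mean_le_arith_mean_pow Finset.univ (labelProb P) (fun y => √(g y))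
    (fun y _ => labelProb_nonneg hP y) (sum_labelProb P) (fun y _ => Real.sqrt_nonneg _) 2
  simpa only [Real.sq_sqrt (hg _)] using h

/-- Bilinear form of the noise and the fit, bounded by the norm of the coefficients and the
correlations of the noise with the columns of the design. -/
theorem sum_mul_mulVec_le (S : Matrix (Fin n) (Fin L) ℝ) (e : Fin n → ℝ)
    (b : EuclideanSpace ℝ (Fin L)) {B : ℝ} (hb : ‖b‖ ^ 2 ≤ B) :
    ∑ i, e i * (S *ᵥ b.ofLp) i ≤ √B * √(∑ l, (∑ i, S i l * e i) ^ 2) := by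
  have h1 : ∑ i, e i * (S *ᵥ b.ofLp) i = ∑ l, b l * ∑ i, S i l * e i := by
    simp_rw [Matrix.mulVec, dotProduct, Finset.mul_sum]
    rw [Finset.sum_comm]
    exact Finset.sum_congr rfl fun l _ => Finset.sum_congr rfl fun i _ => by ring
  have h2 := Real.sum_mul_le_sqrt_mul_sqrt Finset.univ (fun l => b l) fun l => ∑ i, S i l * e i
  rw [h1]
  refine h2.trans (mul_le_mul_of_nonneg_right (Real.sqrt_le_sqrt ?_) (Real.sqrt_nonneg _))
  rwa [← EuclideanSpace.real_norm_sq_eq]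

/-- For a fixed design, the expected risk of the constrained fit exceeds the risk of any feasible
coefficient vector by at most the stochastic term. -/
theorem sum_labelProb_mul_risk_fit_le {P : Fin n → ℝ} (hP : ∀ i, 0 < P i ∧ P i < 1)
    (hn : 1 ≤ n) {S : Matrix (Fin n) (Fin L) ℝ} (hS : ∀ i l, S i l ^ 2 ≤ 1) {B : ℝ}
    {bhat : (Fin n → Bool) → EuclideanSpace ℝ (Fin L)}
    (hbhat : ∀ y, IsConstrainedLogisticFit S y B (bhat y))
    {b : EuclideanSpace ℝ (Fin L)} (hb : ‖b‖ ^ 2 ≤ B) :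
    ∑ y, labelProb P y * logisticRisk P (S *ᵥ (bhat y).ofLp) ≤
      logisticRisk P (S *ᵥ b.ofLp) + √B * √(L * (n * pTilde P)) / n := by
  have hn' : (0 : ℝ) < n := by exact_mod_cast hn
  set e : (Fin n → Bool) → Fin n → ℝ := fun y i => labelValue (y i) - P i with he
  set G : (Fin n → Bool) → ℝ := fun y => ∑ l, (∑ i, S i l * e y i) ^ 2 with hG
  have hpt : ∀ y, logisticRisk P (S *ᵥ (bhat y).ofLp) ≤ logisticRisk P (S *ᵥ b.ofLp) -
      1 / (n : ℝ) * ∑ i, e y i * (S *ᵥ b.ofLp) i + √B / n * √(G y) := by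
    intro y
    have h1 := logisticRisk_eq_add P (fun i => labelValue (y i)) (S *ᵥ (bhat y).ofLp)
    have h2 := logisticRisk_eq_add P (fun i => labelValue (y i)) (S *ᵥ b.ofLp)
    have h3 := (hbhat y).2 b hb
    have h4 := mul_le_mul_of_nonneg_left (sum_mul_mulVec_le S (e y) (bhat y) (hbhat y).1)
      (by positivity : 0 ≤ 1 / (n : ℝ))
    have h5 : 1 / (n : ℝ) * (√B * √(G y)) = √B / n * √(G y) := by ring
    linarith
  have hmean : ∑ y, labelProb P y * ∑ i, e y i * (S *ᵥ b.ofLp) i = 0 := by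
    simp_rw [Finset.mul_sum]
    rw [Finset.sum_comm]
    refine Finset.sum_eq_zero fun i _ => ?_
    simp_rw [← mul_assoc]
    rw [← Finset.sum_mul, he, sum_labelProb_mul_noise, zero_mul]
  have hGmean : ∑ y, labelProb P y * G y ≤ L * (n * pTilde P) := by
    simp_rw [hG, Finset.mul_sum]
    rw [Finset.sum_comm]
    simp_rw [he, sum_labelProb_mul_sum_noise_sq]
    have : ∀ l : Fin L, ∑ i, S i l ^ 2 * (P i * (1 - P i)) ≤ n * pTilde P := fun l => by
      rw [pTilde, ← mul_assoc, mul_one_div_cancel hn'.ne', one_mul]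
      refine Finset.sum_le_sum fun i _ => mul_le_of_le_one_left ?_ (hS i l)
      exact mul_nonneg (hP i).1.le (by linarith [(hP i).2])
    refine (Finset.sum_le_sum fun l _ => this l).trans_eq ?_
    simp
  have hsqrt := (sum_labelProb_mul_sqrt_le hP (g := G)
    fun y => Finset.sum_nonneg fun l _ => sq_nonneg _).trans (Real.sqrt_le_sqrt hGmean)
  calc ∑ y, labelProb P y * logisticRisk P (S *ᵥ (bhat y).ofLp)
      ≤ ∑ y, labelProb P y * (logisticRisk P (S *ᵥ b.ofLp) -
          1 / (n : ℝ) * ∑ i, e y i * (S *ᵥ b.ofLp) i + √B / n * √(G y)) :=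
        Finset.sum_le_sum fun y _ => mul_le_mul_of_nonneg_left (hpt y) (labelProb_nonneg hP y)
    _ = (∑ y, labelProb P y) * logisticRisk P (S *ᵥ b.ofLp) -
          1 / (n : ℝ) * (∑ y, labelProb P y * ∑ i, e y i * (S *ᵥ b.ofLp) i) +
          √B / n * ∑ y, labelProb P y * √(G y) := by
        rw [Finset.sum_mul, Finset.mul_sum, Finset.mul_sum, ← Finset.sum_sub_distrib,
          ← Finset.sum_add_distrib]
        exact Finset.sum_congr rfl fun y _ => by ring
    _ ≤ logisticRisk P (S *ᵥ b.ofLp) + √B * √(L * (n * pTilde P)) / n := by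
        rw [sum_labelProb, hmean, one_mul, mul_zero, sub_zero, mul_div_right_comm]
        gcongr

end Risk

/-! ### The comparator on random designs -/

/-- The coefficient vector `b*` that makes the hashed design reproduce `X β` on average. -/
noncomputable def comparator {p L : ℕ} (w β : Fin p → ℝ)
    (ω : Fin L → Equiv.Perm (Fin p) × (Fin p → ℤˣ)) : EuclideanSpace ℝ (Fin L) :=
  WithLp.toLp 2 fun l => weightedSignSum w β (ω l) / L

theorem norm_comparator_sq {p L : ℕ} (w β : Fin p → ℝ)
    (ω : Fin L → Equiv.Perm (Fin p) × (Fin p → ℤˣ)) :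
    ‖comparator w β ω‖ ^ 2 = ∑ l, (weightedSignSum w β (ω l) / L) ^ 2 := by
  rw [EuclideanSpace.real_norm_sq_eq]
  rfl

/-- The hashed design as a function of the independent copies. -/
noncomputable def copiesMatrix {n p L : ℕ} (X : Matrix (Fin n) (Fin p) ℝ)
    (ω : Fin L → Equiv.Perm (Fin p) × (Fin p → ℤˣ)) : Matrix (Fin n) (Fin L) ℝ :=
  hashedMatrix X (fun l => (ω l).1) (Matrix.of fun k l => (ω l).2 k)

theorem copiesMatrix_apply {n p L : ℕ} (X : Matrix (Fin n) (Fin p) ℝ)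
    (ω : Fin L → Equiv.Perm (Fin p) × (Fin p → ℤˣ)) (i : Fin n) (l : Fin L) :
    copiesMatrix X ω i l = hashedEntry X i (ω l) := rfl

theorem copiesMatrix_mulVec_comparator {n p L : ℕ} (X : Matrix (Fin n) (Fin p) ℝ)
    (w β : Fin p → ℝ) (ω : Fin L → Equiv.Perm (Fin p) × (Fin p → ℤˣ)) (i : Fin n) :
    (copiesMatrix X ω *ᵥ (comparator w β ω).ofLp) i =
      ∑ l, hashedEntry X i (ω l) * (weightedSignSum w β (ω l) / L) := rfl

/-- For a fixed design the excess risk splits into the stochastic term, the approximation error of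
the comparator, the bias `γ`, and, when the comparator is infeasible, the risk `log 2` of the zero
vector. -/
theorem sum_labelProb_mul_excessRisk_le {n p L : ℕ} {X : Matrix (Fin n) (Fin p) ℝ}
    (hn : 1 ≤ n) {β : EuclideanSpace ℝ (Fin p)} {γ : EuclideanSpace ℝ (Fin n)} {P : Fin n → ℝ}
    (hP : ∀ i, 0 < P i ∧ P i < 1)
    (hmodel : ∀ i, Real.log (P i / (1 - P i)) = (∑ k, X i k * β k) + γ i)
    {S : Matrix (Fin n) (Fin L) ℝ} (hS : ∀ i l, S i l ^ 2 ≤ 1) {B : ℝ} (hB : 0 ≤ B)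
    {bhat : (Fin n → Bool) → EuclideanSpace ℝ (Fin L)}
    (hbhat : ∀ y, IsConstrainedLogisticFit S y B (bhat y)) (b : EuclideanSpace ℝ (Fin L)) :
    ∑ y, labelProb P y * excessRisk X β γ P S (bhat y) ≤
      √B * √(L * (n * pTilde P)) / n +
        1 / (4 * (n : ℝ)) * ∑ i, ((S *ᵥ b.ofLp) i - ∑ k, X i k * β k) ^ 2 +
        ‖γ‖ ^ 2 / (4 * n) + Real.log 2 * if B < ‖b‖ ^ 2 then 1 else 0 := by
  set f : Fin n → ℝ := X *ᵥ β.ofLp + γ.ofLp with hf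
  have hPf : P = fun i => Real.sigmoid (f i) :=
    funext fun i => eq_sigmoid_of_log_odds (hP i) (hmodel i)
  have hlog2 : 0 ≤ Real.log 2 := Real.log_nonneg (by norm_num)
  have hfit : ∀ b₀ : EuclideanSpace ℝ (Fin L), ‖b₀‖ ^ 2 ≤ B →
      ∑ y, labelProb P y * excessRisk X β γ P S (bhat y) ≤
        (logisticRisk P (S *ᵥ b₀.ofLp) - logisticRisk P f) + √B * √(L * (n * pTilde P)) / n := by
    intro b₀ hb₀
    have h := sum_labelProb_mul_risk_fit_le hP hn hS hbhat hb₀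
    simp_rw [excessRisk, mul_sub]
    rw [Finset.sum_sub_distrib, ← Finset.sum_mul, sum_labelProb, one_mul]
    linarith
  have hγ : 0 ≤ ‖γ‖ ^ 2 / (4 * (n : ℝ)) := by positivity
  have happrox : 0 ≤ 1 / (4 * (n : ℝ)) * ∑ i, ((S *ᵥ b.ofLp) i - ∑ k, X i k * β k) ^ 2 :=
    mul_nonneg (by positivity) (Finset.sum_nonneg fun i _ => sq_nonneg _)
  split_ifs with hb
  · have h := hfit 0 (by simpa using hB)
    have h0 : S *ᵥ (0 : EuclideanSpace ℝ (Fin L)).ofLp = 0 := by simp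
    rw [h0, logisticRisk_zero hn] at h
    have hfn : 0 ≤ logisticRisk P f := by
      rw [hPf]
      exact logisticRisk_sigmoid_nonneg f
    linarith
  · have h := hfit b (not_lt.1 hb)
    have hrisk : logisticRisk P (S *ᵥ b.ofLp) - logisticRisk P f ≤
        1 / (n : ℝ) * ∑ i, ((S *ᵥ b.ofLp) i - f i) ^ 2 / 8 := by
      rw [hPf]
      exact logisticRisk_sub_le f _
    have hsplit : 1 / (n : ℝ) * ∑ i, ((S *ᵥ b.ofLp) i - f i) ^ 2 / 8 ≤
        1 / (4 * (n : ℝ)) * ∑ i, ((S *ᵥ b.ofLp) i - ∑ k, X i k * β k) ^ 2 +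
        ‖γ‖ ^ 2 / (4 * n) := by
      have e : 1 / (4 * (n : ℝ)) * ∑ i, ((S *ᵥ b.ofLp) i - ∑ k, X i k * β k) ^ 2 +
          ‖γ‖ ^ 2 / (4 * n) = 1 / (n : ℝ) *
            ∑ i, (((S *ᵥ b.ofLp) i - ∑ k, X i k * β k) ^ 2 + γ i ^ 2) / 4 := by
        rw [EuclideanSpace.real_norm_sq_eq, ← Finset.sum_div, Finset.sum_add_distrib]
        field_simp
      rw [e]
      refine mul_le_mul_of_nonneg_left (Finset.sum_le_sum fun i _ => ?_) (by positivity)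
      have hfi : f i = (∑ k, X i k * β k) + γ i := rfl
      rw [hfi]
      nlinarith [sq_nonneg ((S *ᵥ b.ofLp) i - (∑ k, X i k * β k) + γ i)]
    linarith

end RandomSignHashing

open RandomSignHashing

theorem mainTheorem4 (n p q L : ℕ) (hn : 1 ≤ n) (hq : 1 ≤ q) (hL : 1 ≤ L)
    (X : Matrix (Fin n) (Fin p) ℝ)
    (hX : ∀ i k, |X i k| ≤ 1)
    (hXq : ∀ i, (RandomSignHashing.rowSupport X i).card = q)
    (β : EuclideanSpace ℝ (Fin p)) (γ : EuclideanSpace ℝ (Fin n))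
    (P : Fin n → ℝ)
    (hP : ∀ i, 0 < P i ∧ P i < 1)
    (hmodel : ∀ i, Real.log (P i / (1 - P i)) = (∑ k, X i k * β k) + γ i)
    (η : ℝ) (hη : 0 ≤ η)
    (bhat : (Fin n → Bool) → (Fin L → Equiv.Perm (Fin p)) → Matrix (Fin p) (Fin L) ℤˣ →
      EuclideanSpace ℝ (Fin L))
    (hbhat : ∀ y π Ψ, RandomSignHashing.IsConstrainedLogisticFit
      (RandomSignHashing.hashedMatrix X π Ψ) y
      ((1 + η) * ((2 - (q : ℝ) / p) * q * ‖β‖ ^ 2 / L)) (bhat y π Ψ)) :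
    RandomSignHashing.pTilde P ≤ 1 / 2 ∧
    RandomSignHashing.expectation P (fun y π Ψ =>
        RandomSignHashing.excessRisk X β γ P (RandomSignHashing.hashedMatrix X π Ψ)
          (bhat y π Ψ)) ≤
      Real.sqrt ((2 - (q : ℝ) / p) * q) * ‖β‖ *
          ((Real.sqrt ((1 + η) * RandomSignHashing.pTilde P) +
            RandomSignHashing.Lstar n p q β / (4 * L)) / Real.sqrt n) +
        Real.log 2 * RandomSignHashing.rho p q L η + ‖γ‖ ^ 2 / (4 * n) := by
  refine ⟨(pTilde_le_quarter hn P).trans (by norm_num), ?_⟩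
  have hn' : (0 : ℝ) < n := by exact_mod_cast hn
  have hL' : (0 : ℝ) < L := by exact_mod_cast hL
  have hq' : (0 : ℝ) < q := by exact_mod_cast hq
  have hqp : q ≤ p := by
    rw [← hXq ⟨0, hn⟩]
    exact (Finset.card_le_univ _).trans_eq (Fintype.card_fin p)
  have hp' : (0 : ℝ) < p := by exact_mod_cast hq.trans hqp
  obtain ⟨w, hw, hw2, hw1⟩ := exists_hash_weights hq hqp
  have hV : 0 < (2 - (q : ℝ) / p) * q := by
    have : (q : ℝ) / p ≤ 1 := (div_le_one hp').2 (by exact_mod_cast hqp)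
    exact mul_pos (by linarith) hq'
  have hrho : rho p q L η =
      Real.exp (-(L * η ^ 2 / (2 * ((2 - (q : ℝ) / p) * q) * (3 + 2 * η)))) := by
    rw [rho]
    congr 3
    ring
  have hLstar : Lstar n p q β = √((2 - (q : ℝ) / p) * q) * √n * ‖β‖ := by
    rw [Lstar, Real.sqrt_mul hV.le]
  rw [hrho, hLstar]
  set V : ℝ := (2 - (q : ℝ) / p) * q
  have hβ : ∑ k, β k ^ 2 = ‖β‖ ^ 2 := (EuclideanSpace.real_norm_sq_eq β).symm
  set B : ℝ := (1 + η) * (V * ‖β‖ ^ 2 / L) with hBdef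
  have hB : 0 ≤ B := by positivity
  have hpt : 0 ≤ pTilde P :=
    mul_nonneg (by positivity)
      (Finset.sum_nonneg fun i _ => mul_nonneg (hP i).1.le (by linarith [(hP i).2]))
  -- The radius of the constraint set and the noise level combine so that `L` cancels.
  have hstoch : √B * √(L * (n * pTilde P)) / n =
      √V * ‖β‖ * (√((1 + η) * pTilde P) / √n) := by
    have e : B * (L * (n * pTilde P)) =
        V * ‖β‖ ^ 2 * ((1 + η) * pTilde P) * n := by
      rw [hBdef]
      field_simp
    rw [← Real.sqrt_mul hB, e, Real.sqrt_mul (by positivity), Real.sqrt_mul (by positivity),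
      Real.sqrt_mul hV.le, Real.sqrt_sq (norm_nonneg _)]
    have : (n : ℝ) = √n * √n := (Real.mul_self_sqrt hn'.le).symm
    have hsn : 0 < √(n : ℝ) := Real.sqrt_pos.2 hn'
    rw [div_eq_iff hn'.ne']
    nth_rewrite 3 [this]
    field_simp
  have hdesign : ∀ ω : Fin L → Equiv.Perm (Fin p) × (Fin p → ℤˣ),
      ∑ y, labelProb P y *
        excessRisk X β γ P (copiesMatrix X ω)
          (bhat y (fun l => (ω l).1) (Matrix.of fun k l => (ω l).2 k)) ≤
      √B * √(L * (n * pTilde P)) / n +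
        1 / (4 * (n : ℝ)) * ∑ i, (∑ l, hashedEntry X i (ω l) *
          (weightedSignSum w β (ω l) / L) - ∑ k, X i k * β k) ^ 2 +
        ‖γ‖ ^ 2 / (4 * n) + Real.log 2 *
          if B < ∑ l, (weightedSignSum w β (ω l) / L) ^ 2 then 1 else 0 := by
    intro ω
    have hS : ∀ i l, copiesMatrix X ω i l ^ 2 ≤ 1 := fun i l => by
      rw [copiesMatrix_apply]
      exact hashedEntry_sq_le_one hX i (ω l)
    have h := sum_labelProb_mul_excessRisk_le (S := copiesMatrix X ω) hn hP hmodel hS hB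
      (fun y => hbhat y (fun l => (ω l).1) (Matrix.of fun k l => (ω l).2 k))
      (comparator w (fun k => β k) ω)
    simp_rw [copiesMatrix_mulVec_comparator] at h
    rw [norm_comparator_sq] at h
    exact h
  have hexp : expectation P (fun y π Ψ =>
        excessRisk X β γ P (hashedMatrix X π Ψ)
          (bhat y π Ψ)) =
      Finset.expect Finset.univ fun ω : Fin L → Equiv.Perm (Fin p) × (Fin p → ℤˣ) =>
        ∑ y, labelProb P y *
        excessRisk X β γ P (copiesMatrix X ω)
          (bhat y (fun l => (ω l).1) (Matrix.of fun k l => (ω l).2 k)) := by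
    rw [expectation, Finset.expect_sum_comm]
    refine Finset.sum_congr rfl fun y _ => ?_
    rw [← Finset.mul_expect, expect_expect_eq_expect_copies fun π Ψ =>
      excessRisk X β γ P (hashedMatrix X π Ψ) (bhat y π Ψ)]
    rfl
  rw [hexp]
  refine (Finset.expect_le_expect fun ω _ => hdesign ω).trans ?_
  rw [Finset.expect_add_distrib, Finset.expect_add_distrib, Finset.expect_add_distrib,
    Fintype.expect_const, Fintype.expect_const, ← Finset.mul_expect, ← Finset.mul_expect,
    Finset.expect_sum_comm, hstoch]
  have htail := expect_norm_gt_le hL hV hw hw2 (fun k => β k) hη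
  have happrox := Finset.sum_le_sum fun (i : Fin n) (_ : i ∈ Finset.univ) =>
    expect_comparator_sub_sq_le hL hq hX hw2 hw1 (hXq i) fun k => β k
  rw [hβ] at htail
  rw [Finset.sum_const, Finset.card_univ, Fintype.card_fin, nsmul_eq_mul, hβ] at happrox
  have hlog2 : 0 ≤ Real.log 2 := Real.log_nonneg (by norm_num)
  have h1 := mul_le_mul_of_nonneg_left htail hlog2
  have h2 := mul_le_mul_of_nonneg_left happrox (by positivity : 0 ≤ 1 / (4 * (n : ℝ)))
  have h3 : √V * ‖β‖ * ((√((1 + η) * pTilde P) +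
      √V * √n * ‖β‖ / (4 * L)) / √n) =
      √V * ‖β‖ * (√((1 + η) * pTilde P) / √n) +
        1 / (4 * (n : ℝ)) * (n * (V * ‖β‖ ^ 2 / L)) := by
    have hsn : 0 < √(n : ℝ) := Real.sqrt_pos.2 hn'
    rw [show V * ‖β‖ ^ 2 / L = √V * √V * ‖β‖ ^ 2 / L by rw [Real.mul_self_sqrt hV.le]]
    field_simp
  rw [h3]
  linarith
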